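/- Let $\mathcal H$ be a real Hilbert space, $A,B:\mathcal H\rightrightarrows\mathcal H$ maximally monotone operators with $C:=\operatorname{zer}B=\{x: 0\in Bx\}\neq\emptyset$, and $D:\mathcal H\to\mathcal H$ a monotone and $\eta^{-1}$-Lipschitz continuous operator, $\eta>0$. Let $m\ge 1$ and, for $i=1,\dots,m$, let $\mathcal G_i$ be a real Hilbert space, $A_i,D_i:\mathcal G_i\rightrightarrows\mathcal G_i$ maximally monotone operators such that $D_i^{-1}:\mathcal G_i\to\mathcal G_i$ is single-valued, everywhere defined and $\nu_i^{-1}$-Lipschitz continuous for some $\nu_i>0$, and $L_i:\mathcal H\to\mathcal G_i$ a nonzero continuous linear operator with adjoint $L_i^*$. Let $A_i\,\square\,D_i=(A_i^{-1}+D_i^{-1})^{-1}$ be the parallel sum, $N_C(x)=\{u:\langle u,y-x\rangle\le 0\ \forall y\in C\}$ for $x\in C$ and $N_C(x)=\emptyset$ for $x\notin C$ the normal cone, $J_M=(\mathrm{Id}+M)^{-1}$ the resolvent, $\sigma_C(u)=\sup_{y\in C}\langle u,y\rangle$, and $\varphi_B(x,u)=\sup\{\langle x,v\rangle+\langle y,u\rangle-\langle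 y,v\rangle : v\in By\}$ the Fitzpatrick function of $B$. Consider the primal problem of finding $x\in\mathcal H$ with $$0\in Ax+\sum_{i=1}^m L_i^*(A_i\,\square\,D_i)(L_ix)+Dx+N_C(x)\tag{P}$$ and the dual problem of finding $(v_1,\dots,v_m)\in\mathcal G_1\times\dots\times\mathcal G_m$ such that $$\exists x\in\mathcal H:\quad v_i\in(A_i\,\square\,D_i)(L_ix)\ (i=1,\dots,m)\quad\text{and}\quad 0\in Ax+\sum_{i=1}^m L_i^*v_i+Dx+N_C(x).\tag{D}$$ Let $(\lambda_n)_{n\ge1}$, $(\beta_n)_{n\ge1}$ be sequences of positive real numbers, and let sequences be generated from arbitrary $x_1\in\mathcal H$, $v_{i,1}\in\mathcal G_i$ by, for $n\ge1$ and $i=1,\dots,m$, $$\begin{aligned} y_{1,n}&=x_n-\lambda_n\Big(\sum_{i=1}^mL_i^*v_{i,n}+Dx_n\Big),\\ y_{2,i,n}&=v_{i,n}-\lambda_n\big(D_i^{-1}v_{i,n}-L_ix_n\big),\\ p_{1,n}&=J_{\lambda_nA}\,y_{1,n},\qquad p_{2,i,n}=J_{\lambda_nA_i^{-1}}\,y_{2,i,n},\\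 q_n&=p_{1,n}-\lambda_n\Big(\sum_{i=1}^mL_i^*p_{2,i,n}+Dp_{1,n}\Big),\\ v_{i,n+1}&=v_{i,n}-y_{2,i,n}+p_{2,i,n}-\lambda_n\big(D_i^{-1}p_{2,i,n}-L_ip_{1,n}\big),\\ x_{n+1}&=J_{\lambda_n\beta_nB}\,(x_n-y_{1,n}+q_n). \end{aligned}$$ Assume that 1. $A+N_C$ is maximally monotone and (P) has a solution; 2. for every $p\in\operatorname{Ran}N_C$, $\displaystyle\sum_{n\ge1}\lambda_n\beta_n\Big(\sup_{u\in C}\varphi_B\big(u,\tfrac p{\beta_n}\big)-\sigma_C\big(\tfrac p{\beta_n}\big)\Big)<+\infty$; 3. $(\lambda_n)_{n\ge1}\in\ell^2\setminus\ell^1$. Then the averages $\big(\sum_{k=1}^n\lambda_k\big)^{-1}\sum_{k=1}^n\lambda_kx_k$ converge weakly to a solution of (P), and the averages $\big(\sum_{k=1}^n\lambda_k\big)^{-1}\sum_{k=1}^n\lambda_k(v_{1,k},\dots,v_{m,k})$ converge weakly to a solution of (D), as $n\to\infty$. If, in addition, $A$ and all $A_i^{-1}$, $i=1,\dots,m$,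 are strongly monotone, then (P) and (D) each have exactly one solution, $(x_n)$ converges strongly to the solution of (P), and $(v_{1,n},\dots,v_{m,n})$ converges strongly to the solution of (D). -/

import Mathlib

open Filter Topology
open scoped Pointwise RealInnerProductSpace

namespace PrimalDual

section Operators

variable {E : Type*} [NormedAddCommGroup E] [InnerProductSpace ℝ E]

/-- Set-valued operators on a space. -/
abbrev SetOp (E : Type*) := E → Set E

/-- Monotonicity of a set-valued operator. -/
def IsMonotone (M : SetOp E) : Prop :=
  ∀ x y : E, ∀ u ∈ M x, ∀ v ∈ M y, 0 ≤ ⟪x - y, u - v⟫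

/-- Maximal monotonicity: there is no proper monotone extension of the graph. The order on
`E → Set E` is pointwise inclusion, that is, inclusion of graphs. -/
def IsMaxMonotone (M : SetOp E) : Prop :=
  Maximal IsMonotone M

/-- Strong monotonicity with parameter `γ`. -/
def IsStronglyMonotone (γ : ℝ) (M : SetOp E) : Prop :=
  ∀ x y : E, ∀ u ∈ M x, ∀ v ∈ M y, γ * ‖x - y‖ ^ 2 ≤ ⟪x - y, u - v⟫

/-- The inverse of a set-valued operator. -/
def opInv (M : SetOp E) : SetOp E := fun u => {x | u ∈ M x}

/-- The pointwise (Minkowski) sum of set-valued operators. -/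
def opAdd (M N : SetOp E) : SetOp E := fun x => M x + N x

/-- The multiple `c M` of a set-valued operator. -/
def opSMul (c : ℝ) (M : SetOp E) : SetOp E := fun x => c • M x

/-- The set of zeros of a set-valued operator. -/
def zer (M : SetOp E) : Set E := {x | 0 ∈ M x}

/-- The range of a set-valued operator. -/
def ran (M : SetOp E) : Set E := ⋃ x, M x

/-- The parallel sum `M □ N = (M⁻¹ + N⁻¹)⁻¹`. -/
def parallelSum (M N : SetOp E) : SetOp E := opInv (opAdd (opInv M) (opInv N))

/-- The resolvent `J_M = (Id + M)⁻¹`, as a set-valued operator. -/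
def resolvent (M : SetOp E) : SetOp E := opInv (opAdd (fun x => {x}) M)

/-- The normal cone to `S`; it is empty at points outside `S`. -/
def normalCone (S : Set E) : SetOp E := fun x => {u | x ∈ S ∧ ∀ y ∈ S, ⟪u, y - x⟫ ≤ 0}

/-- The support function of `S`, with values in the extended reals. -/
noncomputable def supportFun (S : Set E) (u : E) : EReal :=
  ⨆ y ∈ S, ((⟪u, y⟫ : ℝ) : EReal)

/-- The Fitzpatrick function of `M`, with values in the extended reals. -/
noncomputable def fitzpatrick (M : SetOp E) (x u : E) : EReal :=
  ⨆ y : E, ⨆ v ∈ M y, ((⟪x, v⟫ + ⟪y, u⟫ - ⟪y, v⟫ : ℝ) : EReal)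

/-- The quantity `sup_{u ∈ C} φ_B(u, p) - σ_C(p)`, where `C = zer B`. -/
noncomputable def fitzpatrickGap (B : SetOp E) (p : E) : EReal :=
  (⨆ u ∈ zer B, fitzpatrick B u p) - supportFun (zer B) p

/-- If `C` is nonempty and `σ_C(p)` is not `+∞`, the gap is nonnegative. Every multiple of an element of the range of
the normal cone to `C` by a positive number is such a `p`. Hence the conversion to `[0, ∞]` in
`PenaltySummable` below truncates nothing. -/
theorem fitzpatrickGap_nonneg (B : SetOp E) (p : E) (hC : (zer B).Nonempty)
    (hp : supportFun (zer B) p ≠ ⊤) :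
    0 ≤ fitzpatrickGap B p := by
  have key : supportFun (zer B) p ≤ ⨆ u ∈ zer B, fitzpatrick B u p := by
    refine iSup₂_mono fun u hu => ?_
    have hu' : (0 : E) ∈ B u := hu
    refine le_trans ?_ (le_iSup_of_le u (le_iSup₂_of_le 0 hu' le_rfl))
    simp [real_inner_comm]
  unfold fitzpatrickGap
  obtain ⟨y, hy⟩ := hC
  have hb : supportFun (zer B) p ≠ ⊥ := by
    refine ne_of_gt (lt_of_lt_of_le (EReal.bot_lt_coe ⟪p, y⟫) ?_)
    exact le_iSup₂_of_le (f := fun z (_ : z ∈ zer B) => ((⟪p, z⟫ : ℝ) : EReal)) y hy le_rfl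
  exact (EReal.sub_nonneg (Or.inr hp) (Or.inr hb)).mpr key

/-- The penalty condition: for every `p` in the range of the normal cone to `C = zer B`, the series
`∑_{n ≥ 1} λ_n β_n (sup_{u ∈ C} φ_B(u, p / β_n) - σ_C(p / β_n))` of elements of `[0, ∞]` has a
finite sum. -/
def PenaltySummable (B : SetOp E) (lam bet : ℕ → ℝ) : Prop :=
  ∀ p ∈ ran (normalCone (zer B)),
    ∑' n : ℕ, ENNReal.ofReal (lam (n + 1) * bet (n + 1)) *
      (fitzpatrickGap B ((bet (n + 1))⁻¹ • p)).toENNReal < ⊤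

/-- The weighted averages `z_n = (∑_{k=1}^n λ_k)⁻¹ ∑_{k=1}^n λ_k x_k`. -/
noncomputable def ergodicAverage (lam : ℕ → ℝ) (x : ℕ → E) (n : ℕ) : E :=
  (∑ k ∈ Finset.Icc 1 n, lam k)⁻¹ • ∑ k ∈ Finset.Icc 1 n, lam k • x k

/-- Weak convergence of a sequence. -/
def WeaklyConverges (x : ℕ → E) (a : E) : Prop :=
  Tendsto (fun n => toWeakSpace ℝ E (x n)) atTop (𝓝 (toWeakSpace ℝ E a))

end Operators

section Problem

variable {H : Type*} [NormedAddCommGroup H] [InnerProductSpace ℝ H] [CompleteSpace H]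
  {m : ℕ} {G : Fin m → Type*} [∀ i, NormedAddCommGroup (G i)]
  [∀ i, InnerProductSpace ℝ (G i)] [∀ i, CompleteSpace (G i)]

/-- The operator `x ↦ A x + ∑ i, L_i^* (A_i □ D_i) (L_i x) + D x + N_C x`, with `C = zer B`. -/
noncomputable def primalOp (A B : SetOp H) (D : H → H) (Ai Di : ∀ i, SetOp (G i))
    (L : ∀ i, H →L[ℝ] G i) : SetOp H := fun x =>
  A x + (∑ i, (L i).adjoint '' parallelSum (Ai i) (Di i) (L i x)) + {D x} + normalCone (zer B) x

/-- Solutions of the primal inclusion. -/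
def primalSolutions (A B : SetOp H) (D : H → H) (Ai Di : ∀ i, SetOp (G i))
    (L : ∀ i, H →L[ℝ] G i) : Set H :=
  zer (primalOp A B D Ai Di L)

/-- Solutions of the dual inclusion, in the Hilbert space `G_1 × … × G_m`. -/
def dualSolutions (A B : SetOp H) (D : H → H) (Ai Di : ∀ i, SetOp (G i))
    (L : ∀ i, H →L[ℝ] G i) : Set (PiLp 2 G) :=
  {v | ∃ x : H, (∀ i, v i ∈ parallelSum (Ai i) (Di i) (L i x)) ∧
    0 ∈ A x + {∑ i, (L i).adjoint (v i)} + {D x} + normalCone (zer B) x}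

/-- The sequences `x` and `v`, indexed by `n ≥ 1` (the terms at `0` play no role), are generated by
the primal-dual algorithm, with auxiliary sequences `y₁`, `y₂`, `p₁`, `p₂`, `q`. Here `Dinv i` is
the single-valued inverse of `D_i`. Resolvents of maximally monotone operators are single-valued and
everywhere defined, so that membership means equality in the backward steps. -/
structure IsPrimalDualIteration (A B : SetOp H) (D : H → H) (Ai : ∀ i, SetOp (G i))
    (Dinv : ∀ i, G i → G i) (L : ∀ i, H →L[ℝ] G i) (lam bet : ℕ → ℝ)
    (x : ℕ → H) (v : ℕ → PiLp 2 G) (y₁ p₁ q : ℕ → H) (y₂ p₂ : ℕ → ∀ i, G i) : Prop where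
  y₁_eq : ∀ n ≥ 1, y₁ n = x n - lam n • (∑ i, (L i).adjoint (v n i) + D (x n))
  y₂_eq : ∀ n ≥ 1, ∀ i, y₂ n i = v n i - lam n • (Dinv i (v n i) - L i (x n))
  p₁_mem : ∀ n ≥ 1, p₁ n ∈ resolvent (opSMul (lam n) A) (y₁ n)
  p₂_mem : ∀ n ≥ 1, ∀ i, p₂ n i ∈ resolvent (opSMul (lam n) (opInv (Ai i))) (y₂ n i)
  q_eq : ∀ n ≥ 1, q n = p₁ n - lam n • (∑ i, (L i).adjoint (p₂ n i) + D (p₁ n))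
  v_succ : ∀ n ≥ 1, ∀ i,
    v (n + 1) i = v n i - y₂ n i + p₂ n i - lam n • (Dinv i (p₂ n i) - L i (p₁ n))
  x_succ : ∀ n ≥ 1, x (n + 1) ∈ resolvent (opSMul (lam n * bet n) B) (x n - y₁ n + q n)

end Problem

end PrimalDual

/-!
On the Hilbert space `H × G₁ × … × G_m` put `M (x, v) = A x × A₁⁻¹ v₁ × … × A_m⁻¹ v_m`, let `N` be the
normal cone to `zer B × G₁ × … × G_m`, and let `Q` collect the single-valued terms, that is,
`Q (x, v) = (∑ i, L_i^* v_i + D x, (D_i⁻¹ v_i - L_i x)_i)`. The zeros of `M + N + Q` are the pairs of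
a dual solution and a primal point that certifies it (`product_zero_iff`), `Q` is monotone and
Lipschitz, and the algorithm is Tseng's forward-backward-forward method for `M + Q`, followed by a
backward step in the penalized operator (`IsPenaltyScheme`).

For a pair `(u, w)` in the graph of `M + N + Q`, one step of the method yields
`‖z_{n+1} - u‖² ≤ ‖z_n - u‖² - γ λ_n ‖z_n - u‖² - 2 λ_n ⟪w, z_n - u⟫ + δ_n` for large `n`, where `γ` is a
modulus of strong monotonicity of `M`, possibly `0`, and `∑ δ_n < ∞` because `∑ λ_n² < ∞` and the
Fitzpatrick condition holds (`one_step_estimate`, `PenaltySummable.exists_error`).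

With `w = 0`, the distance from `z_n` to each solution converges. With arbitrary `w`, summation shows
that each weak cluster point `a` of the weighted averages satisfies `⟪w, a - u⟫ ≤ 0` on the graph of
`M + N + Q`, and hence is a zero (`IsPenaltyScheme.exists_zero_of_related`). The Opial–Passty lemma
(`exists_weaklyConverges_average`) then gives weak convergence of the averages. With `w = 0` and
`γ > 0`, the series `∑ λ_n ‖z_n - u‖²` converges although `∑ λ_n = ∞`, and the convergent sequence
`‖z_n - u‖²` must tend to `0`. Applied to every solution, this also gives uniqueness.

Maximality enters through Minty's theorem (`IsMaxMonotone.exists_add_smul_eq`), proved by minimizing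
the sum of the Fitzpatrick function and `‖·‖² / 2`. It is needed only for `A + N_C` and for the
operators `A_i⁻¹` separately, so that no sum theorem for maximally monotone operators is used.
-/

namespace PrimalDual

/-! ### Surjectivity of `Id + t M` for maximally monotone `M` -/

section Minty

/-- A closed convex set of pairs `(z, t)` on which `t + ‖z‖² / 2` is bounded below contains a
minimizer of this function, here expressed through its first-order optimality condition. -/
theorem exists_optimal_of_closed_convex {X : Type*} [NormedAddCommGroup X] [InnerProductSpace ℝ X]
    [CompleteSpace X] {S : Set (X × ℝ)} (hS : IsClosed S) (hconv : Convex ℝ S) (hne : S.Nonempty)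
    (hbdd : ∀ e ∈ S, 0 ≤ e.2 + ‖e.1‖ ^ 2 / 2) :
    ∃ e₀ ∈ S, ∀ e ∈ S, e₀.2 + ‖e₀.1‖ ^ 2 ≤ e.2 + ⟪e₀.1, e.1⟫ := by
  set val : X × ℝ → ℝ := fun e => e.2 + ‖e.1‖ ^ 2 / 2 with hval
  set μ : ℝ := sInf (val '' S) with hμ
  have hbb : BddBelow (val '' S) := ⟨0, by rintro _ ⟨e, he, rfl⟩; exact hbdd e he⟩
  have hμle : ∀ e ∈ S, μ ≤ val e := fun e he => csInf_le hbb ⟨e, he, rfl⟩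
  have hex : ∀ n : ℕ, ∃ e ∈ S, val e < μ + 1 / ((n : ℝ) + 1) := by
    intro n
    obtain ⟨_, ⟨e, he, rfl⟩, h⟩ := exists_lt_of_csInf_lt (hne.image val)
      (lt_add_of_pos_right μ (Nat.one_div_pos_of_nat (n := n)))
    exact ⟨e, he, h⟩
  choose e heS hev using hex
  -- The parallelogram law makes every minimizing sequence a Cauchy sequence.
  have hdist : ∀ n m N : ℕ, N ≤ n → N ≤ m →
      dist (e n).1 (e m).1 ≤ √(8 * (1 / ((N : ℝ) + 1))) := by
    intro n m N hn hm
    have hmid := hμle _ (hconv (heS n) (heS m) (by norm_num : (0 : ℝ) ≤ 1 / 2)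
      (by norm_num : (0 : ℝ) ≤ 1 / 2) (by norm_num))
    have hp := parallelogram_law_with_norm ℝ (e n).1 (e m).1
    have h1 := hev n
    have h2 := hev m
    have h3 : 1 / ((n : ℝ) + 1) ≤ 1 / ((N : ℝ) + 1) := Nat.one_div_le_one_div hn
    have h4 : 1 / ((m : ℝ) + 1) ≤ 1 / ((N : ℝ) + 1) := Nat.one_div_le_one_div hm
    simp only [hval, Prod.fst_add, Prod.snd_add, Prod.smul_fst, Prod.smul_snd, smul_eq_mul,
      ← smul_add, norm_smul] at hmid h1 h2
    norm_num [mul_pow] at hmid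
    rw [dist_eq_norm]
    apply Real.le_sqrt_of_sq_le
    nlinarith
  have hcau : CauchySeq fun n => (e n).1 := by
    refine cauchySeq_of_le_tendsto_0 _ hdist ?_
    have := (tendsto_one_div_add_atTop_nhds_zero_nat (𝕜 := ℝ)).const_mul 8
    simpa [Function.comp_def] using (Real.continuous_sqrt.tendsto _).comp this
  obtain ⟨z, hz⟩ := cauchySeq_tendsto_of_complete hcau
  have hvlim : Tendsto (fun n => val (e n)) atTop (𝓝 μ) := by
    refine tendsto_of_tendsto_of_tendsto_of_le_of_le tendsto_const_nhds ?_
      (fun n => hμle _ (heS n)) (fun n => (hev n).le)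
    simpa using (tendsto_one_div_add_atTop_nhds_zero_nat (𝕜 := ℝ)).const_add μ
  have htlim : Tendsto (fun n => (e n).2) atTop (𝓝 (μ - ‖z‖ ^ 2 / 2)) := by
    refine (hvlim.sub ((hz.norm.pow 2).div_const 2)).congr fun n => ?_
    simp [hval]
  have hmem : (z, μ - ‖z‖ ^ 2 / 2) ∈ S :=
    hS.mem_of_tendsto (hz.prodMk_nhds htlim) (Eventually.of_forall heS)
  refine ⟨_, hmem, fun f hf => ?_⟩
  -- Compare the minimum with the values on the segment towards `f`, and let `s → 0`.
  have hs : ∀ s ∈ Set.Ioc (0 : ℝ) 1,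
      0 ≤ f.2 - (μ - ‖z‖ ^ 2 / 2) + ⟪z, f.1 - z⟫ + s * (‖f.1 - z‖ ^ 2 / 2) := by
    intro s hs
    have h1 := hμle _ (hconv.add_smul_sub_mem hmem hf ⟨hs.1.le, hs.2⟩)
    simp only [hval, Prod.fst_add, Prod.snd_add, Prod.smul_fst, Prod.smul_snd, smul_eq_mul,
      Prod.fst_sub, Prod.snd_sub] at h1
    rw [norm_add_sq_real, inner_smul_right, norm_smul, mul_pow, Real.norm_eq_abs, sq_abs] at h1
    refine nonneg_of_mul_nonneg_right ?_ hs.1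
    nlinarith
  have hlim : Tendsto (fun s : ℝ => f.2 - (μ - ‖z‖ ^ 2 / 2) + ⟪z, f.1 - z⟫
      + s * (‖f.1 - z‖ ^ 2 / 2)) (𝓝[>] 0)
      (𝓝 (f.2 - (μ - ‖z‖ ^ 2 / 2) + ⟪z, f.1 - z⟫ + 0 * (‖f.1 - z‖ ^ 2 / 2))) :=
    ((Continuous.tendsto (by fun_prop) 0).mono_left nhdsWithin_le_nhds)
  have h0 := ge_of_tendsto hlim
    (Filter.mem_of_superset (Ioc_mem_nhdsGT (zero_lt_one' ℝ)) hs)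
  rw [inner_sub_right, real_inner_self_eq_norm_sq] at h0
  simp only
  linarith

variable {E : Type*} [NormedAddCommGroup E] [InnerProductSpace ℝ E]

/-- A maximally monotone operator contains every pair that is monotonically related to its
graph. -/
theorem IsMaxMonotone.mem_of_related {M : SetOp E} (hM : IsMaxMonotone M) {x u : E}
    (h : ∀ y, ∀ v ∈ M y, 0 ≤ ⟪x - y, u - v⟫) : u ∈ M x := by
  have hext : IsMonotone (fun y => M y ∪ {w | y = x ∧ w = u}) := by
    rintro y y' w (hw | ⟨rfl, rfl⟩) w' (hw' | ⟨rfl, rfl⟩)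
    · exact hM.1 _ _ _ hw _ hw'
    · have := h _ _ hw
      rwa [← neg_sub, ← neg_sub w', inner_neg_neg]
    · exact h _ _ hw'
    · simp
  exact hM.2 hext (fun y w hw => Or.inl hw) x (Or.inr ⟨rfl, rfl⟩)

/-- The inverse of a maximally monotone operator is maximally monotone. -/
theorem IsMaxMonotone.opInv {M : SetOp E} (hM : IsMaxMonotone M) :
    IsMaxMonotone (opInv M) := by
  have hinv : ∀ {N : SetOp E}, IsMonotone N → IsMonotone (PrimalDual.opInv N) :=
    fun hN x y u hu v hv => by rw [real_inner_comm]; exact hN u v x hu y hv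
  refine ⟨hinv hM.1, fun N hN hle x u hu => ?_⟩
  exact hM.2 (hinv hN) (fun y v hv => hle v hv) u hu

/-- The heart of Minty's theorem. Let `F` be the Fitzpatrick function of `M`. A minimizer
`(x₀, u₀)` of `F + ‖·‖² / 2` satisfies `-(x₀, u₀) ∈ ∂F(x₀, u₀)`, and together with
`F(x, u) ≥ ⟪x, u⟫` this forces `(-u₀, -x₀)` to be monotonically related to the graph of `M`. -/
theorem exists_neg_mem_of_related [CompleteSpace E] {M : SetOp E} (hM : IsMonotone M)
    (hmax : ∀ x u, (∀ y, ∀ v ∈ M y, 0 ≤ ⟪x - y, u - v⟫) → u ∈ M x) : ∃ x, -x ∈ M x := by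
  set S : Set (WithLp 2 (E × E) × ℝ) :=
    {e | ∀ y, ∀ v ∈ M y, ⟪e.1.fst, v⟫ + ⟪y, e.1.snd⟫ - ⟪y, v⟫ ≤ e.2} with hSdef
  have hcont₁ : Continuous fun e : WithLp 2 (E × E) × ℝ => e.1.fst :=
    (WithLp.fstL 2 ℝ E E).continuous.comp continuous_fst
  have hcont₂ : Continuous fun e : WithLp 2 (E × E) × ℝ => e.1.snd :=
    (WithLp.sndL 2 ℝ E E).continuous.comp continuous_fst
  have hS : IsClosed S := by
    simp only [hSdef, Set.ofPred_forall]
    refine isClosed_iInter fun y => isClosed_iInter fun v => isClosed_iInter fun _ => ?_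
    exact isClosed_le (by fun_prop) (by fun_prop)
  have hconv : Convex ℝ S := by
    intro e he f hf a b ha hb hab y v hv
    have h1 := mul_le_mul_of_nonneg_left (he y v hv) ha
    have h2 := mul_le_mul_of_nonneg_left (hf y v hv) hb
    simp only [Prod.fst_add, Prod.snd_add, Prod.smul_fst, Prod.smul_snd, smul_eq_mul,
      WithLp.add_fst, WithLp.add_snd, WithLp.smul_fst, WithLp.smul_snd, inner_add_left,
      inner_add_right, inner_smul_left, inner_smul_right]
    simp only [conj_trivial]
    have hc : ⟪y, v⟫ = a * ⟪y, v⟫ + b * ⟪y, v⟫ := by rw [← add_mul, hab, one_mul]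
    linarith
  have hne : S.Nonempty := by
    have : ∃ y v, v ∈ M y := by
      by_contra! h
      exact h 0 0 (hmax 0 0 fun y v hv => absurd hv (h y v))
    obtain ⟨y, v, hv⟩ := this
    refine ⟨(WithLp.toLp 2 (y, v), ⟪y, v⟫), fun y' v' hv' => ?_⟩
    have := hM y y' v hv v' hv'
    simp only [inner_sub_left, inner_sub_right] at this
    simp only [WithLp.toLp_fst, WithLp.toLp_snd]
    linarith
  have hge : ∀ e ∈ S, ⟪e.1.fst, e.1.snd⟫ ≤ e.2 := by
    intro e he
    by_cases hmem : e.1.snd ∈ M e.1.fst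
    · have := he _ _ hmem
      linarith
    · by_contra hlt
      refine hmem (hmax _ _ fun y v hv => ?_)
      have := he y v hv
      simp only [inner_sub_left, inner_sub_right]
      linarith
  have hsq : ∀ x u : E, 0 ≤ ‖x‖ ^ 2 + ‖u‖ ^ 2 + 2 * ⟪x, u⟫ := fun x u => by
    have := norm_add_sq_real x u
    nlinarith [sq_nonneg ‖x + u‖]
  obtain ⟨⟨z, t⟩, he₀, hopt⟩ := exists_optimal_of_closed_convex hS hconv hne fun e he => by
    have h1 := hge e he
    have h2 := hsq e.1.fst e.1.snd
    have h3 := WithLp.prod_norm_sq_eq_of_L2 e.1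
    linarith
  have ht := hge _ he₀
  have hzn := WithLp.prod_norm_sq_eq_of_L2 z
  have hkey : ∀ y, ∀ v ∈ M y, ‖z.fst + z.snd‖ ^ 2 ≤ ⟪-z.snd - y, -z.fst - v⟫ := by
    intro y v hv
    have h := hopt (WithLp.toLp 2 (y, v), ⟪y, v⟫) fun y' v' hv' => by
      have := hM y y' v hv v' hv'
      simp only [inner_sub_left, inner_sub_right] at this
      simp only [WithLp.toLp_fst, WithLp.toLp_snd]
      linarith
    simp only [WithLp.prod_inner_apply, WithLp.ofLp_fst, WithLp.ofLp_snd] at h ht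
    rw [norm_add_sq_real]
    simp only [inner_sub_left, inner_sub_right, inner_neg_left, inner_neg_right]
    rw [real_inner_comm z.fst z.snd, real_inner_comm z.fst y]
    linarith
  have hmem : -z.fst ∈ M (-z.snd) := hmax _ _ fun y v hv => (sq_nonneg _).trans (hkey y v hv)
  have h0 := hkey _ _ hmem
  simp only [sub_self, inner_zero_left] at h0
  have hz0 : z.fst + z.snd = 0 := norm_eq_zero.1 (pow_eq_zero_iff two_ne_zero |>.1
    (le_antisymm h0 (sq_nonneg _)))
  exact ⟨z.fst, by rwa [← eq_neg_of_add_eq_zero_left hz0] at hmem⟩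

/-- Minty's theorem: `Id + t M` is surjective if `M` is maximally monotone and `t > 0`. -/
theorem IsMaxMonotone.exists_add_smul_eq [CompleteSpace E] {M : SetOp E} (hM : IsMaxMonotone M)
    {t : ℝ} (ht : 0 < t) (z : E) : ∃ u, ∃ a ∈ M u, u + t • a = z := by
  obtain ⟨x, hx⟩ := exists_neg_mem_of_related (M := fun x => {b | t⁻¹ • b ∈ M (x + z)})
    (fun x y u hu v hv => by
      have := hM.1 _ _ _ hu _ hv
      rw [add_sub_add_right_eq_sub, ← smul_sub, inner_smul_right] at this
      exact nonneg_of_mul_nonneg_right this (inv_pos.2 ht))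
    (fun x u h => hM.mem_of_related fun y v hv => by
      have := h (y - z) (t • v) (by simpa [smul_smul, inv_mul_cancel₀ ht.ne'] using hv)
      have h2 : x + z - y = x - (y - z) := by abel
      have h3 : t⁻¹ • u - v = t⁻¹ • (u - t • v) := by
        rw [smul_sub, smul_smul, inv_mul_cancel₀ ht.ne', one_smul]
      rw [h2, h3, inner_smul_right]
      exact mul_nonneg (inv_pos.2 ht).le this)
  refine ⟨x + z, _, hx, ?_⟩
  rw [smul_smul, mul_inv_cancel₀ ht.ne', one_smul]
  abel

end Minty

/-! ### Weak limits of weighted averages -/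

section Weak

variable {E : Type*} [NormedAddCommGroup E] [InnerProductSpace ℝ E]

/-- By the Riesz representation theorem, weak convergence is convergence of inner products. -/
theorem weaklyConverges_iff_inner [CompleteSpace E] {x : ℕ → E} {a : E} :
    WeaklyConverges x a ↔ ∀ y, Tendsto (fun n => ⟪x n, y⟫) atTop (𝓝 ⟪a, y⟫) := by
  have key : WeaklyConverges x a ↔
      ∀ f : StrongDual ℝ E, Tendsto (fun n => f (x n)) atTop (𝓝 (f a)) := by
    refine WeakBilin.tendsto_iff_forall_eval_tendsto (B := (topDualPairing ℝ E).flip) ?_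
    intro u w huw
    refine (InnerProductSpace.toDual ℝ E).injective ?_
    ext y
    have := DFunLike.congr_fun huw ((InnerProductSpace.toDual ℝ E) y)
    simpa [topDualPairing, real_inner_comm] using this
  rw [key]
  constructor
  · intro h y
    simpa [real_inner_comm] using h (InnerProductSpace.toDual ℝ E y)
  · intro h f
    have hf : ∀ z, f z = ⟪z, (InnerProductSpace.toDual ℝ E).symm f⟫ := fun z => by
      rw [real_inner_comm, InnerProductSpace.toDual_symm_apply]
    simpa only [hf] using h ((InnerProductSpace.toDual ℝ E).symm f)

/-- Continuous linear maps between Hilbert spaces preserve weak convergence. -/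
theorem WeaklyConverges.map [CompleteSpace E] {F : Type*} [NormedAddCommGroup F]
    [InnerProductSpace ℝ F] [CompleteSpace F] {x : ℕ → E} {a : E} (h : WeaklyConverges x a)
    (T : E →L[ℝ] F) : WeaklyConverges (fun n => T (x n)) (T a) := by
  rw [weaklyConverges_iff_inner] at h ⊢
  intro y
  simpa [ContinuousLinearMap.adjoint_inner_right] using h (T.adjoint y)

/-- A bounded sequence in a Hilbert space converges weakly along every ultrafilter. -/
theorem exists_tendsto_inner_ultrafilter [CompleteSpace E] {x : ℕ → E} {R : ℝ}
    (hx : ∀ n, ‖x n‖ ≤ R) (U : Ultrafilter ℕ) :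
    ∃ a, ∀ y, Tendsto (fun n => ⟪x n, y⟫) U (𝓝 ⟪a, y⟫) := by
  have hK := WeakDual.isCompact_closedBall (0 : StrongDual ℝ E) R
  set g : ℕ → WeakDual ℝ E :=
    fun n => StrongDual.toWeakDual (InnerProductSpace.toDual ℝ E (x n)) with hg
  have hmem : ∀ n, g n ∈ WeakDual.toStrongDual ⁻¹' Metric.closedBall (0 : StrongDual ℝ E) R := by
    intro n
    simpa [hg] using hx n
  obtain ⟨f, -, hf⟩ := hK.ultrafilter_le_nhds (U.map g)
    (tendsto_principal.2 (Eventually.of_forall hmem))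
  refine ⟨(InnerProductSpace.toDual ℝ E).symm (WeakDual.toStrongDual f), fun y => ?_⟩
  have h1 : Tendsto (fun n => g n y) U (𝓝 (f y)) :=
    ((WeakDual.eval_continuous y).tendsto f).comp hf
  simpa [hg] using h1

variable {lam : ℕ → ℝ}

/-- Weighted averages, with weights of infinite total mass, of a convergent sequence of reals
converge to the same limit. -/
theorem tendsto_weighted_average (hlam : ∀ n, 0 < lam n) (hl1 : ¬ Summable lam) {c : ℕ → ℝ}
    {l : ℝ} (hc : Tendsto c atTop (𝓝 l)) :
    Tendsto (fun n => (∑ k ∈ Finset.range n, lam k)⁻¹ * ∑ k ∈ Finset.range n, lam k * c k) atTop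
      (𝓝 l) := by
  have hdiv : Tendsto (fun n => ∑ k ∈ Finset.range n, lam k) atTop atTop :=
    (not_summable_iff_tendsto_nat_atTop_of_nonneg fun n => (hlam n).le).1 hl1
  have ho : (fun n => lam n * (c n - l)) =o[atTop] lam := by
    have : (fun n => c n - l) =o[atTop] fun _ => (1 : ℝ) :=
      (Asymptotics.isLittleO_one_iff ℝ).2 (tendsto_sub_nhds_zero_iff.2 hc)
    simpa using (Asymptotics.isBigO_refl lam atTop).mul_isLittleO this
  have h := (ho.sum_range (fun n => (hlam n).le) hdiv).tendsto_div_nhds_zero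
  rw [← tendsto_sub_nhds_zero_iff]
  refine h.congr' ?_
  filter_upwards [hdiv.eventually_gt_atTop 0] with n hn
  simp only [mul_sub, Finset.sum_sub_distrib, ← Finset.sum_mul]
  field_simp

/-- The Opial–Passty lemma. Let `x` be a sequence whose distance to each point of `S` converges.
If every weak limit of its weighted averages along an ultrafilter lies in `S`, the averages converge
weakly to a point of `S`. -/
theorem exists_weaklyConverges_average [CompleteSpace E] (hlam : ∀ n, 0 < lam n)
    (hl1 : ¬ Summable lam) {x : ℕ → E} {S : Set E} (hne : S.Nonempty)
    (hdist : ∀ u ∈ S, ∃ l, Tendsto (fun n => ‖x n - u‖ ^ 2) atTop (𝓝 l))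
    (hclus : ∀ (U : Ultrafilter ℕ) (a : E), (U : Filter ℕ) ≤ atTop →
      (∀ y, Tendsto (fun n => ⟪(∑ k ∈ Finset.range n, lam k)⁻¹ •
        ∑ k ∈ Finset.range n, lam k • x k, y⟫) U (𝓝 ⟪a, y⟫)) → a ∈ S) :
    ∃ a ∈ S, WeaklyConverges (fun n => (∑ k ∈ Finset.range n, lam k)⁻¹ •
        ∑ k ∈ Finset.range n, lam k • x k) a := by
  set X : ℕ → E := fun n => (∑ k ∈ Finset.range n, lam k)⁻¹ •
        ∑ k ∈ Finset.range n, lam k • x k with hX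
  obtain ⟨R, hR⟩ : ∃ R, ∀ n, ‖x n‖ ≤ R := by
    obtain ⟨u, hu⟩ := hne
    obtain ⟨l, hl⟩ := hdist u hu
    obtain ⟨C, hC⟩ := hl.bddAbove_range
    refine ⟨√C + ‖u‖, fun n => ?_⟩
    have h1 : ‖x n - u‖ ≤ √C := Real.le_sqrt_of_sq_le (hC ⟨n, rfl⟩)
    have h2 : ‖x n‖ ≤ ‖x n - u‖ + ‖u‖ := by simpa using norm_add_le (x n - u) u
    linarith
  have hR0 : 0 ≤ R := (norm_nonneg _).trans (hR 0)
  have hXR : ∀ n, ‖X n‖ ≤ R := by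
    intro n
    have hs : 0 ≤ ∑ k ∈ Finset.range n, lam k := Finset.sum_nonneg fun k _ => (hlam k).le
    have h1 : ‖∑ k ∈ Finset.range n, lam k • x k‖ ≤ (∑ k ∈ Finset.range n, lam k) * R := by
      rw [Finset.sum_mul]
      refine norm_sum_le_of_le _ fun k _ => ?_
      rw [norm_smul, Real.norm_of_nonneg (hlam k).le]
      exact mul_le_mul_of_nonneg_left (hR k) (hlam k).le
    simp only [hX]
    rw [norm_smul, norm_inv, Real.norm_of_nonneg hs]
    rcases hs.eq_or_lt with h0 | h0
    · simpa [← h0] using hR0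
    · rw [inv_mul_le_iff₀ h0]
      exact h1
  -- Two weak limits `a`, `b` have the same inner product with `a - b`.
  have huniq : ∀ (U V : Ultrafilter ℕ) (a b : E), (U : Filter ℕ) ≤ atTop →
      (V : Filter ℕ) ≤ atTop → (∀ y, Tendsto (fun n => ⟪X n, y⟫) U (𝓝 ⟪a, y⟫)) →
      (∀ y, Tendsto (fun n => ⟪X n, y⟫) V (𝓝 ⟪b, y⟫)) → a = b := by
    intro U V a b hU hV ha hb
    obtain ⟨l, hl⟩ := hdist a (hclus U a hU ha)
    obtain ⟨l', hl'⟩ := hdist b (hclus V b hV hb)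
    have h1 : Tendsto (fun n => ⟪x n, a - b⟫) atTop
        (𝓝 ((l' - l + ‖a‖ ^ 2 - ‖b‖ ^ 2) / 2)) := by
      refine ((((hl'.sub hl).add_const (‖a‖ ^ 2)).sub_const (‖b‖ ^ 2)).div_const 2).congr
        fun n => ?_
      rw [norm_sub_sq_real, norm_sub_sq_real, inner_sub_right]
      ring
    have h2 : Tendsto (fun n => ⟪X n, a - b⟫) atTop
        (𝓝 ((l' - l + ‖a‖ ^ 2 - ‖b‖ ^ 2) / 2)) := by
      refine (tendsto_weighted_average hlam hl1 h1).congr fun n => ?_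
      simp only [hX, real_inner_smul_left, sum_inner]
    have h3 := tendsto_nhds_unique (ha (a - b)) (h2.mono_left hU)
    have h4 := tendsto_nhds_unique (hb (a - b)) (h2.mono_left hV)
    have h5 : ⟪a - b, a - b⟫ = 0 := by rw [inner_sub_left, h3, h4, sub_self]
    exact sub_eq_zero.1 (inner_self_eq_zero.1 h5)
  have hU₀ : ((Ultrafilter.of atTop : Ultrafilter ℕ) : Filter ℕ) ≤ atTop := Ultrafilter.of_le _
  obtain ⟨a, ha⟩ := exists_tendsto_inner_ultrafilter hXR (Ultrafilter.of atTop)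
  refine ⟨a, hclus _ a hU₀ ha, weaklyConverges_iff_inner.2 fun y => ?_⟩
  rw [tendsto_iff_ultrafilter]
  intro V hV
  obtain ⟨b, hb⟩ := exists_tendsto_inner_ultrafilter hXR V
  rw [huniq _ V a b hU₀ hV ha hb]
  exact hb y

end Weak

/-! ### The forward-backward-forward penalty scheme for one inclusion -/

section Scheme

/-- If `a` is nonnegative and eventually `a (n + 1) ≤ a n - b n + δ n` with `δ` summable, the partial
sums of `b`, of whatever sign, are bounded above. -/
theorem exists_sum_le_of_le_sub_add {a b δ : ℕ → ℝ} (ha : ∀ n, 0 ≤ a n) (hδ : Summable δ)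
    (hδ0 : ∀ n, 0 ≤ δ n) (h : ∀ᶠ n in atTop, a (n + 1) ≤ a n - b n + δ n) :
    ∃ c, ∀ᶠ n in atTop, ∑ k ∈ Finset.range n, b k ≤ c := by
  obtain ⟨N, hN⟩ := eventually_atTop.1 h
  refine ⟨∑' k, δ k + (a N + ∑ k ∈ Finset.range N, b k), eventually_atTop.2 ⟨N, fun n hn => ?_⟩⟩
  have hind : a n + ∑ k ∈ Finset.range n, b k ≤
      ∑ k ∈ Finset.range n, δ k + (a N + ∑ k ∈ Finset.range N, b k) := by
    induction n, hn using Nat.le_induction with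
    | base =>
      have : 0 ≤ ∑ k ∈ Finset.range N, δ k := Finset.sum_nonneg fun k _ => hδ0 k
      linarith
    | succ n hn ih =>
      rw [Finset.sum_range_succ, Finset.sum_range_succ]
      linarith [hN n hn]
  linarith [ha n, hδ.sum_le_tsum (Finset.range n) fun k _ => hδ0 k]

/-- A nonnegative sequence that is decreasing up to summable errors converges. -/
theorem exists_tendsto_of_le_add {a δ : ℕ → ℝ} (ha : ∀ n, 0 ≤ a n) (hδ : Summable δ)
    (h : ∀ᶠ n in atTop, a (n + 1) ≤ a n + δ n) : ∃ l, Tendsto a atTop (𝓝 l) := by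
  obtain ⟨N, hN⟩ := eventually_atTop.1 h
  set c : ℕ → ℝ := fun n => a (n + N) - ∑ k ∈ Finset.range (n + N), δ k with hc
  have hanti : Antitone c := antitone_nat_of_succ_le fun n => by
    have := hN (n + N) (Nat.le_add_left _ _)
    have h2 : n + 1 + N = n + N + 1 := by omega
    simp only [hc, h2, Finset.sum_range_succ]
    linarith
  have hδlim := (hδ.hasSum.tendsto_sum_nat.comp (tendsto_add_atTop_nat N))
  obtain ⟨C, hC⟩ := hδlim.bddAbove_range
  have hbdd : BddBelow (Set.range c) := by
    refine ⟨-C, ?_⟩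
    rintro _ ⟨n, rfl⟩
    have : ∑ k ∈ Finset.range (n + N), δ k ≤ C := hC ⟨n, rfl⟩
    simp only [hc]
    linarith [ha (n + N)]
  refine ⟨(⨅ n, c n) + ∑' k, δ k, (tendsto_add_atTop_iff_nat N).1 ?_⟩
  refine ((tendsto_atTop_ciInf hanti hbdd).add hδlim).congr fun n => ?_
  simp [hc]

variable {E : Type*} [NormedAddCommGroup E] [InnerProductSpace ℝ E]

/-- The inequality for one step `z ↦ z'` of the scheme, with forward-backward point `p`, compared
with a point `u` such that `w = v + ξ + Q u`, where `v ∈ M u` and `ξ ∈ N u`. The hypothesis `hM` is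
(strong) monotonicity of `M`, and `hB` is the backward step in the penalized operator. -/
theorem one_step_estimate {Q : E → E} {κ γ t ε : ℝ} (hκ : ∀ x y, ‖Q x - Q y‖ ≤ κ * ‖x - y‖)
    (hQ : ∀ x y, 0 ≤ ⟪x - y, Q x - Q y⟫) (hγ : 0 ≤ γ) (ht : 0 < t)
    (htκ : t ^ 2 * κ ^ 2 ≤ 1 / 8) (htγ : t * γ ≤ 1 / 8) {z z' p u v ξ : E}
    (hM : t * γ * ‖p - u‖ ^ 2 ≤ ⟪z - p - t • Q z - t • v, p - u⟫)
    (hB : t * ⟪ξ, z' - u⟫ - ε ≤ ⟪z' - u, p + t • (Q z - Q p) - z'⟫) :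
    ‖z' - u‖ ^ 2 ≤ ‖z - u‖ ^ 2 - γ * (t * ‖z - u‖ ^ 2) - 2 * (t * ⟪v + ξ + Q u, z - u⟫)
      + (t ^ 2 * (4 * ‖v + ξ + Q u‖ ^ 2 + 3 * ‖ξ‖ ^ 2) + 2 * ε) := by
  set w := v + ξ + Q u with hw
  set d := p - u with hd
  set e := z - p with he
  set g := Q z - Q p with hg
  set s := p + t • g - z' with hs
  have hzu : z - u = e + d := by simp [he, hd]
  have hz'u : z' - u = d + t • g - s := by simp only [hs, hd]; abel
  have hQpu := hQ p u
  rw [← hd] at hQpu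
  have hgn : ‖g‖ ^ 2 ≤ κ ^ 2 * ‖e‖ ^ 2 := by
    have := pow_le_pow_left₀ (norm_nonneg _) (hκ z p) 2
    rwa [mul_pow] at this
  have htg : t ^ 2 * ‖g‖ ^ 2 ≤ 1 / 8 * ‖e‖ ^ 2 := by
    calc t ^ 2 * ‖g‖ ^ 2 ≤ t ^ 2 * (κ ^ 2 * ‖e‖ ^ 2) :=
          mul_le_mul_of_nonneg_left hgn (sq_nonneg t)
      _ = t ^ 2 * κ ^ 2 * ‖e‖ ^ 2 := by ring
      _ ≤ _ := mul_le_mul_of_nonneg_right htκ (sq_nonneg _)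
  have hMd : t * γ * ‖d‖ ^ 2 ≤ ⟪e, d⟫ - t * ⟪g, d⟫ - t * ⟪Q p, d⟫ - t * ⟪v, d⟫ := by
    have hQz : Q z = g + Q p := by simp [hg]
    rw [hQz] at hM
    simpa only [inner_sub_left, inner_add_left, real_inner_smul_left, mul_add, sub_sub,
      add_assoc] using hM
  rw [hz'u] at hB
  have hyoung : ∀ (r : ℝ) (a b : E), 2 * r * ⟪a, b⟫ ≤ r ^ 2 * ‖a‖ ^ 2 + ‖b‖ ^ 2 := by
    intro r a b
    have h1 := norm_sub_sq_real (r • a) b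
    rw [norm_smul, mul_pow, Real.norm_eq_abs, sq_abs, real_inner_smul_left] at h1
    linarith [sq_nonneg ‖r • a - b‖]
  -- The weights are chosen so that the error terms use up at most `3 / 4 * ‖e‖ ^ 2` and `‖s‖ ^ 2`.
  have hy1 := hyoung (4 * t) w e
  have hy2 := hyoung (2 * t) ξ s
  have hy3 := mul_le_mul_of_nonneg_left (hyoung (-1) ξ g) (sq_nonneg t)
  have hed : ‖e + d‖ ^ 2 ≤ 2 * ‖e‖ ^ 2 + 2 * ‖d‖ ^ 2 := by
    have := hyoung 1 e d
    rw [norm_add_sq_real]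
    linarith
  have hγed : γ * (t * ‖e + d‖ ^ 2) ≤ 1 / 4 * ‖e‖ ^ 2 + 2 * (t * γ * ‖d‖ ^ 2) := by
    have h1 := mul_le_mul_of_nonneg_left hed (mul_nonneg ht.le hγ)
    have h2 := mul_le_mul_of_nonneg_right htγ (sq_nonneg ‖e‖)
    linarith
  have hQd : ⟪d, Q p - Q u⟫ = ⟪Q p, d⟫ - ⟪Q u, d⟫ := by
    rw [real_inner_comm, inner_sub_left]
  rw [hQd] at hQpu
  have htQ := mul_nonneg ht.le hQpu
  have hwd : ⟪w, d⟫ = ⟪v, d⟫ + ⟪ξ, d⟫ + ⟪Q u, d⟫ := by rw [hw, inner_add_left, inner_add_left]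
  -- Expand the squares of the distances to `u` before and after the backward step, and add up.
  have hfs := norm_add_sq_real (d + t • g - s) s
  rw [sub_add_cancel] at hfs
  have hf := norm_add_sq_real d (t • g)
  rw [norm_smul, mul_pow, Real.norm_eq_abs, sq_abs, real_inner_smul_right,
    real_inner_comm g d] at hf
  have hξ : ⟪ξ, d + t • g - s⟫ = ⟪ξ, d⟫ + t * ⟪ξ, g⟫ - ⟪ξ, s⟫ := by
    rw [inner_sub_right, inner_add_right, real_inner_smul_right]
  rw [hξ] at hB
  have hedn := norm_add_sq_real e d
  rw [hzu, hz'u, inner_add_right, hwd]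
  linarith [sq_nonneg ‖e‖, sq_nonneg ‖s‖]

/-- The data of a penalty scheme with forward-backward-forward steps for the inclusion
`0 ∈ M z + N z + Q z`, where `Q` is single-valued. The penalized operator, whose set of zeros has
`N` as its normal cone, enters only through the estimate `penalty` for its backward step. -/
structure IsPenaltyScheme (M N : SetOp E) (Q : E → E) (κ : ℝ) (lam : ℕ → ℝ) (z p : ℕ → E) :
    Prop where
  lam_pos : ∀ n, 0 < lam n
  lam_sq : Summable fun n => lam n ^ 2
  lam_not_summable : ¬ Summable lam
  lipschitz : ∀ x y, ‖Q x - Q y‖ ≤ κ * ‖x - y‖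
  monotone : ∀ x y, 0 ≤ ⟪x - y, Q x - Q y⟫
  step : ∀ n, ∃ a ∈ M (p n), z n - lam n • Q (z n) = p n + lam n • a
  penalty : ∀ u, ∀ ξ ∈ N u, ∃ ε : ℕ → ℝ, Summable ε ∧ (∀ n, 0 ≤ ε n) ∧ ∀ n,
    lam n * ⟪ξ, z (n + 1) - u⟫ - ε n ≤
      ⟪z (n + 1) - u, p n + lam n • (Q (z n) - Q (p n)) - z (n + 1)⟫

namespace IsPenaltyScheme

variable {M N : SetOp E} {Q : E → E} {κ : ℝ} {lam : ℕ → ℝ} {z p : ℕ → E}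

/-- Along the scheme, `‖z n - u‖ ^ 2` decreases up to summable errors and a term that is controlled
by the value `v + ξ + Q u` of the operator at `u`. -/
theorem eventually_norm_sub_sq_le (h : IsPenaltyScheme M N Q κ lam z p) {γ : ℝ} (hγ : 0 ≤ γ)
    (hM : IsStronglyMonotone γ M) {u v ξ : E} (hv : v ∈ M u) (hξ : ξ ∈ N u) :
    ∃ δ : ℕ → ℝ, Summable δ ∧ (∀ n, 0 ≤ δ n) ∧ ∀ᶠ n in atTop,
      ‖z (n + 1) - u‖ ^ 2 ≤ ‖z n - u‖ ^ 2 - γ * (lam n * ‖z n - u‖ ^ 2)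
        - 2 * (lam n * ⟪v + ξ + Q u, z n - u⟫) + δ n := by
  obtain ⟨ε, hε, hε0, hpen⟩ := h.penalty u ξ hξ
  refine ⟨fun n => lam n ^ 2 * (4 * ‖v + ξ + Q u‖ ^ 2 + 3 * ‖ξ‖ ^ 2) + 2 * ε n,
    (h.lam_sq.mul_right _).add (hε.mul_left 2), fun n => ?_, ?_⟩
  · have := hε0 n
    positivity
  have hsq : Tendsto (fun n => lam n ^ 2) atTop (𝓝 0) := h.lam_sq.tendsto_atTop_zero
  have hlim : Tendsto lam atTop (𝓝 0) := by
    have := (Real.continuous_sqrt.tendsto _).comp hsq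
    rw [Real.sqrt_zero] at this
    exact this.congr fun n => Real.sqrt_sq (h.lam_pos n).le
  have h1 : ∀ᶠ n in atTop, lam n ^ 2 * κ ^ 2 < 1 / 8 :=
    (hsq.mul_const (κ ^ 2)).eventually_lt_const (by norm_num)
  have h2 : ∀ᶠ n in atTop, lam n * γ < 1 / 8 :=
    (hlim.mul_const γ).eventually_lt_const (by norm_num)
  filter_upwards [h1, h2] with n hn1 hn2
  refine one_step_estimate h.lipschitz h.monotone hγ (h.lam_pos n) hn1.le hn2.le ?_ (hpen n)
  obtain ⟨a, ha, hstep⟩ := h.step n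
  have hz : z n - p n - lam n • Q (z n) - lam n • v = lam n • (a - v) := by
    rw [smul_sub, ← add_sub_cancel_left (p n) (lam n • a), ← hstep, sub_right_comm (z n)]
  rw [hz, real_inner_smul_left, real_inner_comm, mul_assoc]
  exact mul_le_mul_of_nonneg_left (hM _ _ _ ha _ hv) (h.lam_pos n).le

/-- If `M` is strongly monotone, the scheme converges strongly to every solution. -/
theorem tendsto_of_stronglyMonotone (h : IsPenaltyScheme M N Q κ lam z p) {γ : ℝ} (hγ : 0 < γ)
    (hM : IsStronglyMonotone γ M) {u v ξ : E} (hv : v ∈ M u) (hξ : ξ ∈ N u)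
    (h0 : v + ξ + Q u = 0) : Tendsto z atTop (𝓝 u) := by
  obtain ⟨δ, hδ, hδ0, hle⟩ := h.eventually_norm_sub_sq_le hγ.le hM hv hξ
  simp only [h0, inner_zero_left, mul_zero, sub_zero] at hle
  have ha : ∀ n, 0 ≤ ‖z n - u‖ ^ 2 := fun n => sq_nonneg _
  have hb : ∀ n, 0 ≤ γ * (lam n * ‖z n - u‖ ^ 2) := fun n =>
    mul_nonneg hγ.le (mul_nonneg (h.lam_pos n).le (ha n))
  obtain ⟨l, hl⟩ := exists_tendsto_of_le_add ha hδ (hle.mono fun n hn => by linarith [hb n])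
  have hl0 : 0 ≤ l := ge_of_tendsto' hl ha
  -- The partial sums of `γ λ ‖z - u‖²` are bounded, which leaves `0` as the only possible limit.
  have hlz : l = 0 := by
    by_contra hne
    have hlpos : 0 < l := lt_of_le_of_ne hl0 (Ne.symm hne)
    obtain ⟨c, hc⟩ := exists_sum_le_of_le_sub_add ha hδ hδ0 hle
    have hdiv := (not_summable_iff_tendsto_nat_atTop_of_nonneg fun n => (h.lam_pos n).le).1
      h.lam_not_summable
    have hinv : Tendsto (fun n => (∑ k ∈ Finset.range n, lam k)⁻¹ * (c / γ)) atTop (𝓝 0) := by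
      simpa using hdiv.inv_tendsto_atTop.mul_const (c / γ)
    refine hlpos.not_ge (le_of_tendsto_of_tendsto
      (tendsto_weighted_average h.lam_pos h.lam_not_summable hl) hinv ?_)
    filter_upwards [hc, hdiv.eventually_gt_atTop 0] with n hn hpos
    refine mul_le_mul_of_nonneg_left ?_ (inv_pos.2 hpos).le
    rw [← Finset.mul_sum] at hn
    rwa [le_div_iff₀' hγ]
  rw [hlz] at hl
  have hs := (Real.continuous_sqrt.tendsto _).comp hl
  rw [Real.sqrt_zero] at hs
  exact tendsto_iff_norm_sub_tendsto_zero.2 (hs.congr fun n => Real.sqrt_sq (norm_nonneg _))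

/-- A point `a` with `⟪w, a - u⟫ ≤ 0` for all pairs `(u, w)` in the graph of `M + N + Q` is a zero
of `M + N + Q`, provided that `Id + t (M + N)` is surjective for all `t > 0`. To see this, solve
`u + t (v + ξ) = a - t Q a` with `t` so small that `t Q` is a strict contraction: the inequality
for this `u` forces `u = a`. -/
theorem exists_zero_of_related (h : IsPenaltyScheme M N Q κ lam z p)
    (hres : ∀ t : ℝ, 0 < t → ∀ x, ∃ u, ∃ v ∈ M u, ∃ ξ ∈ N u, u + t • (v + ξ) = x) {a : E}
    (ha : ∀ u, ∀ v ∈ M u, ∀ ξ ∈ N u, ⟪v + ξ + Q u, a - u⟫ ≤ 0) :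
    ∃ v ∈ M a, ∃ ξ ∈ N a, v + ξ + Q a = 0 := by
  set t : ℝ := (|κ| + 1)⁻¹ with ht
  have hk : 0 < |κ| + 1 := by positivity
  have htpos : 0 < t := inv_pos.2 hk
  obtain ⟨u, v, hv, ξ, hξ, hu⟩ := hres t htpos (a - t • Q a)
  have hau : a - u = t • (v + ξ + Q a) := by
    rw [smul_add, ← sub_eq_zero]
    rw [← sub_eq_zero] at hu
    rw [← neg_eq_zero, ← hu]
    abel
  have hw : t • (v + ξ + Q u) = (a - u) - t • (Q a - Q u) := by
    rw [hau]
    module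
  have h1 : ⟪t • (v + ξ + Q u), a - u⟫ ≤ 0 := by
    rw [real_inner_smul_left]
    exact mul_nonpos_of_nonneg_of_nonpos htpos.le (ha u v hv ξ hξ)
  rw [hw, inner_sub_left, real_inner_self_eq_norm_sq, real_inner_smul_left] at h1
  have h2 : ⟪Q a - Q u, a - u⟫ ≤ |κ| * ‖a - u‖ ^ 2 := by
    calc ⟪Q a - Q u, a - u⟫ ≤ ‖Q a - Q u‖ * ‖a - u‖ := real_inner_le_norm _ _
      _ ≤ (κ * ‖a - u‖) * ‖a - u‖ :=
          mul_le_mul_of_nonneg_right (h.lipschitz a u) (norm_nonneg _)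
      _ = κ * ‖a - u‖ ^ 2 := by ring
      _ ≤ _ := mul_le_mul_of_nonneg_right (le_abs_self κ) (sq_nonneg _)
  have h3 : t * ‖a - u‖ ^ 2 ≤ 0 := by
    have h4 := mul_le_mul_of_nonneg_left h2 htpos.le
    have h5 : t * |κ| = 1 - t := by
      rw [ht]
      field_simp
      ring
    rw [← mul_assoc, h5] at h4
    linarith
  have h6 : ‖a - u‖ ^ 2 = 0 := le_antisymm (nonpos_of_mul_nonpos_right h3 htpos) (sq_nonneg _)
  have h7 : a - u = 0 := norm_eq_zero.1 (pow_eq_zero_iff two_ne_zero |>.1 h6)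
  have h8 : a = u := sub_eq_zero.1 h7
  rw [h7] at hau
  refine ⟨v, h8 ▸ hv, ξ, h8 ▸ hξ, ?_⟩
  exact (smul_eq_zero.1 hau.symm).resolve_left htpos.ne'

/-- The weighted averages of the scheme converge weakly to a solution. -/
theorem exists_weaklyConverges (h : IsPenaltyScheme M N Q κ lam z p) [CompleteSpace E]
    (hM : IsMonotone M)
    (hres : ∀ t : ℝ, 0 < t → ∀ x, ∃ u, ∃ v ∈ M u, ∃ ξ ∈ N u, u + t • (v + ξ) = x)
    (hne : ∃ u, ∃ v ∈ M u, ∃ ξ ∈ N u, v + ξ + Q u = 0) :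
    ∃ a, (∃ v ∈ M a, ∃ ξ ∈ N a, v + ξ + Q a = 0) ∧
      WeaklyConverges (fun n => (∑ k ∈ Finset.range n, lam k)⁻¹ •
        ∑ k ∈ Finset.range n, lam k • z k) a := by
  have hM0 : IsStronglyMonotone 0 M := fun x y u hu v hv => by
    rw [zero_mul]
    exact hM x y u hu v hv
  refine exists_weaklyConverges_average (S := {a | ∃ v ∈ M a, ∃ ξ ∈ N a, v + ξ + Q a = 0})
    h.lam_pos h.lam_not_summable hne ?_ ?_
  · rintro u ⟨v, hv, ξ, hξ, h0⟩
    obtain ⟨δ, hδ, -, hle⟩ := h.eventually_norm_sub_sq_le le_rfl hM0 hv hξ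
    refine exists_tendsto_of_le_add (fun n => sq_nonneg _) hδ (hle.mono fun n hn => ?_)
    simpa [h0] using hn
  · intro U a hU ha
    refine h.exists_zero_of_related hres fun u v hv ξ hξ => ?_
    obtain ⟨δ, hδ, hδ0, hle⟩ := h.eventually_norm_sub_sq_le le_rfl hM0 hv hξ
    simp only [zero_mul, sub_zero] at hle
    obtain ⟨c, hc⟩ := exists_sum_le_of_le_sub_add (fun n => sq_nonneg ‖z n - u‖) hδ hδ0 hle
    set w := v + ξ + Q u with hw
    have hdiv := (not_summable_iff_tendsto_nat_atTop_of_nonneg fun n => (h.lam_pos n).le).1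
      h.lam_not_summable
    have hinv : Tendsto (fun n => (∑ k ∈ Finset.range n, lam k)⁻¹ * (c / 2)) U (𝓝 0) := by
      simpa using (hdiv.inv_tendsto_atTop.mul_const (c / 2)).mono_left hU
    have hlim := (ha w).sub_const ⟪u, w⟫
    rw [inner_sub_right, real_inner_comm a w, real_inner_comm u w]
    refine le_of_tendsto_of_tendsto hlim hinv (Filter.Eventually.filter_mono hU ?_)
    filter_upwards [hc, hdiv.eventually_gt_atTop 0] with n hn hpos
    have hsum : ∑ k ∈ Finset.range n, 2 * (lam k * ⟪w, z k - u⟫) =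
        2 * (⟪∑ k ∈ Finset.range n, lam k • z k, w⟫
          - (∑ k ∈ Finset.range n, lam k) * ⟪u, w⟫) := by
      rw [← Finset.mul_sum, sum_inner, Finset.sum_mul, ← Finset.sum_sub_distrib]
      congr 1
      refine Finset.sum_congr rfl fun k _ => ?_
      rw [real_inner_smul_left, inner_sub_right, real_inner_comm w, real_inner_comm w, mul_sub]
    rw [hsum] at hn
    rw [real_inner_smul_left, ← mul_le_mul_iff_right₀ hpos, mul_sub, mul_inv_cancel_left₀ hpos.ne',
      mul_inv_cancel_left₀ hpos.ne']
    linarith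

end IsPenaltyScheme

end Scheme

/-! ### The penalty term -/

section Penalty

variable {E : Type*} [NormedAddCommGroup E] [InnerProductSpace ℝ E]

theorem mem_resolvent_opSMul {c : ℝ} {M : SetOp E} {p y : E} :
    p ∈ resolvent (opSMul c M) y ↔ ∃ a ∈ M p, y = p + c • a := by
  simp only [resolvent, opInv, opAdd, opSMul, Set.singleton_add, Set.mem_ofPred_eq, Set.mem_image,
    Set.mem_smul_set]
  constructor
  · rintro ⟨_, ⟨a, ha, rfl⟩, h⟩
    exact ⟨a, ha, h.symm⟩
  · rintro ⟨a, ha, h⟩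
    exact ⟨_, ⟨a, ha, rfl⟩, h.symm⟩

/-- The support function of `S` is attained at `u` for the elements of the normal cone at `u`. -/
theorem supportFun_of_mem_normalCone {S : Set E} {u ξ : E} (hξ : ξ ∈ normalCone S u) :
    supportFun S ξ = ((⟪ξ, u⟫ : ℝ) : EReal) := by
  refine le_antisymm (iSup₂_le fun y hy => ?_)
    (le_iSup₂_of_le (f := fun z (_ : z ∈ S) => ((⟪ξ, z⟫ : ℝ) : EReal)) u hξ.1 le_rfl)
  have := hξ.2 y hy
  rw [inner_sub_right] at this
  exact_mod_cast sub_nonpos.1 this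

/-- A finite gap bounds from below how far the elements of the graph of `B` can violate
monotonicity with respect to `(u, ξ)`, where `ξ` is normal to `zer B` at `u`. -/
theorem le_inner_of_fitzpatrickGap_ne_top {B : SetOp E} {u ξ : E}
    (hξ : ξ ∈ normalCone (zer B) u) (htop : fitzpatrickGap B ξ ≠ ⊤) {x b : E} (hb : b ∈ B x) :
    ⟪ξ, x - u⟫ - (fitzpatrickGap B ξ).toENNReal.toReal ≤ ⟪x - u, b⟫ := by
  set s : EReal := ⨆ u ∈ zer B, fitzpatrick B u ξ with hs
  have hgap : fitzpatrickGap B ξ = s - ((⟪ξ, u⟫ : ℝ) : EReal) := by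
    rw [fitzpatrickGap, supportFun_of_mem_normalCone hξ]
  have hle : ((⟪u, b⟫ + ⟪x, ξ⟫ - ⟪x, b⟫ : ℝ) : EReal) ≤ s := by
    refine le_trans ?_ (le_iSup₂_of_le (f := fun u (_ : u ∈ zer B) => fitzpatrick B u ξ) u hξ.1
      le_rfl)
    exact le_iSup_of_le x (le_iSup₂_of_le (f := fun v (_ : v ∈ B x) =>
      ((⟪u, v⟫ + ⟪x, ξ⟫ - ⟪x, v⟫ : ℝ) : EReal)) b hb le_rfl)
  have hs_bot : s ≠ ⊥ := ne_bot_of_le_ne_bot (EReal.coe_ne_bot _) hle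
  have hs_top : s ≠ ⊤ := by
    intro h
    rw [hgap, h, EReal.top_sub_coe] at htop
    exact htop rfl
  lift s to ℝ using ⟨hs_top, hs_bot⟩ with σ
  rw [hgap, ← EReal.coe_sub, EReal.toENNReal_of_ne_top (EReal.coe_ne_top _), EReal.toReal_coe]
  have h1 := le_max_left (σ - ⟪ξ, u⟫) 0
  have h2 : ⟪u, b⟫ + ⟪x, ξ⟫ - ⟪x, b⟫ ≤ σ := by exact_mod_cast hle
  rw [ENNReal.toReal_ofReal', inner_sub_right, inner_sub_left, real_inner_comm x ξ]
  linarith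

/-- Under the penalty condition, the backward steps in the penalized operator violate monotonicity
with respect to a given element of the normal cone only by summable errors. -/
theorem PenaltySummable.exists_error {B : SetOp E} {lam bet : ℕ → ℝ}
    (h : PenaltySummable B lam bet) (hlam : ∀ n ≥ 1, 0 < lam n) (hbet : ∀ n ≥ 1, 0 < bet n)
    {u ξ : E} (hξ : ξ ∈ normalCone (zer B) u) {x r : ℕ → E}
    (hx : ∀ n ≥ 1, x (n + 1) ∈ resolvent (opSMul (lam n * bet n) B) (r n)) :
    ∃ ε : ℕ → ℝ, Summable ε ∧ (∀ n, 0 ≤ ε n) ∧ ∀ n,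
      lam (n + 1) * ⟪ξ, x (n + 2) - u⟫ - ε n ≤ ⟪x (n + 2) - u, r (n + 1) - x (n + 2)⟫ := by
  set gap : ℕ → ENNReal := fun n => (fitzpatrickGap B ((bet (n + 1))⁻¹ • ξ)).toENNReal with hgap
  have hsum : ∑' n : ℕ, ENNReal.ofReal (lam (n + 1) * bet (n + 1)) * gap n ≠ ⊤ :=
    (h ξ (Set.mem_iUnion.2 ⟨u, hξ⟩)).ne
  refine ⟨fun n => (ENNReal.ofReal (lam (n + 1) * bet (n + 1)) * gap n).toReal,
    ENNReal.summable_toReal hsum, fun n => ENNReal.toReal_nonneg, fun n => ?_⟩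
  have hl := hlam (n + 1) (by omega)
  have hb := hbet (n + 1) (by omega)
  have hlb := mul_pos hl hb
  obtain ⟨b, hbB, hr⟩ := mem_resolvent_opSMul.1 (hx (n + 1) (by omega))
  have hξ' : (bet (n + 1))⁻¹ • ξ ∈ normalCone (zer B) u := by
    refine ⟨hξ.1, fun y hy => ?_⟩
    rw [real_inner_smul_left]
    exact mul_nonpos_of_nonneg_of_nonpos (inv_pos.2 hb).le (hξ.2 y hy)
  have htop : fitzpatrickGap B ((bet (n + 1))⁻¹ • ξ) ≠ ⊤ := by
    intro htop
    have h1 := ENNReal.ne_top_of_tsum_ne_top hsum n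
    simp only [hgap, htop, EReal.toENNReal_top] at h1
    exact h1 (ENNReal.mul_top (ENNReal.ofReal_pos.2 hlb).ne')
  have key := mul_le_mul_of_nonneg_left
    (le_inner_of_fitzpatrickGap_ne_top hξ' htop hbB) hlb.le
  beta_reduce
  rw [ENNReal.toReal_mul, ENNReal.toReal_ofReal hlb.le, hr, add_sub_cancel_left,
    real_inner_smul_right]
  rw [real_inner_smul_left, mul_sub] at key
  have hcancel : lam (n + 1) * bet (n + 1) * ((bet (n + 1))⁻¹ * ⟪ξ, x (n + 2) - u⟫) =
      lam (n + 1) * ⟪ξ, x (n + 2) - u⟫ := by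
    field_simp
  rw [hcancel] at key
  exact key

end Penalty

/-! ### The primal-dual problem as one inclusion in a product space -/

section Product

variable {H : Type*} [NormedAddCommGroup H] [InnerProductSpace ℝ H]
  {m : ℕ} {G : Fin m → Type*} [∀ i, NormedAddCommGroup (G i)]
  [∀ i, InnerProductSpace ℝ (G i)]

/-- The operator `(x, v) ↦ A x × A₁⁻¹ v₁ × … × A_m⁻¹ v_m`. -/
def productOp (A : SetOp H) (Ai : ∀ i, SetOp (G i)) : SetOp (WithLp 2 (H × PiLp 2 G)) :=
  fun z => {w | w.fst ∈ A z.fst ∧ ∀ i, w.snd i ∈ opInv (Ai i) (z.snd i)}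

/-- The normal cone to `C × G₁ × … × G_m`, that is, `(x, v) ↦ N_C x × {0}`. -/
def productNormalCone (C : Set H) : SetOp (WithLp 2 (H × PiLp 2 G)) :=
  fun z => {w | w.fst ∈ normalCone C z.fst ∧ w.snd = 0}

theorem productOp_isStronglyMonotone {γ : ℝ} {A : SetOp H} {Ai : ∀ i, SetOp (G i)}
    (hA : IsStronglyMonotone γ A) (hAi : ∀ i, IsStronglyMonotone γ (opInv (Ai i))) :
    IsStronglyMonotone γ (productOp A Ai) := by
  rintro x y u ⟨hu, hu'⟩ v ⟨hv, hv'⟩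
  rw [WithLp.prod_norm_sq_eq_of_L2, PiLp.norm_sq_eq_of_L2, WithLp.prod_inner_apply,
    PiLp.inner_apply, mul_add, Finset.mul_sum]
  exact add_le_add (hA _ _ _ hu _ hv)
    (Finset.sum_le_sum fun i _ => hAi i _ _ _ (hu' i) _ (hv' i))

/-- `Id + t (M + N)` is surjective for the product operators `M` and `N`, because it acts on each
factor separately. -/
theorem exists_product_resolvent [CompleteSpace H] [∀ i, CompleteSpace (G i)] {A : SetOp H}
    {C : Set H} {Ai : ∀ i, SetOp (G i)} (hsum : IsMaxMonotone (opAdd A (normalCone C)))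
    (hAi : ∀ i, IsMaxMonotone (Ai i)) (t : ℝ) (ht : 0 < t) (z : WithLp 2 (H × PiLp 2 G)) :
    ∃ u, ∃ v ∈ productOp A Ai u, ∃ ξ ∈ productNormalCone C u, u + t • (v + ξ) = z := by
  obtain ⟨x, _, ⟨a, ha, ξ, hξ, rfl⟩, hx⟩ := hsum.exists_add_smul_eq ht z.fst
  choose w b hb hw using fun i => (hAi i).opInv.exists_add_smul_eq ht (z.snd i)
  refine ⟨WithLp.toLp 2 (x, WithLp.toLp 2 w), WithLp.toLp 2 (a, WithLp.toLp 2 b), ⟨ha, hb⟩,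
    WithLp.toLp 2 (ξ, 0), ⟨hξ, rfl⟩, ?_⟩
  refine WithLp.ofLp_injective 2 (Prod.ext hx ?_)
  ext i
  simpa using hw i

variable [CompleteSpace H] [∀ i, CompleteSpace (G i)]

/-- The single-valued part `(x, v) ↦ (∑ i, L_i^* v_i + D x, (D_i⁻¹ v_i - L_i x)_i)` of the
primal-dual inclusion. -/
noncomputable def couplingOp (D : H → H) (Dinv : ∀ i, G i → G i) (L : ∀ i, H →L[ℝ] G i)
    (z : WithLp 2 (H × PiLp 2 G)) : WithLp 2 (H × PiLp 2 G) :=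
  WithLp.toLp 2 (∑ i, (L i).adjoint (z.snd i) + D z.fst,
    WithLp.toLp 2 fun i => Dinv i (z.snd i) - L i z.fst)

/-- The linear part of `couplingOp` is skew, hence `couplingOp` is monotone. -/
theorem couplingOp_monotone {D : H → H} {Dinv : ∀ i, G i → G i} (L : ∀ i, H →L[ℝ] G i)
    (hD : ∀ x y, 0 ≤ ⟪x - y, D x - D y⟫)
    (hDinv : ∀ i x y, 0 ≤ ⟪x - y, Dinv i x - Dinv i y⟫) (x y : WithLp 2 (H × PiLp 2 G)) :
    0 ≤ ⟪x - y, couplingOp D Dinv L x - couplingOp D Dinv L y⟫ := by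
  have h1 : (couplingOp D Dinv L x - couplingOp D Dinv L y).fst =
      ∑ i, (L i).adjoint (x.snd i - y.snd i) + (D x.fst - D y.fst) := by
    simp only [couplingOp, WithLp.sub_fst, WithLp.toLp_fst, map_sub, Finset.sum_sub_distrib]
    abel
  have h2 : ∀ i, (couplingOp D Dinv L x - couplingOp D Dinv L y).snd i =
      (Dinv i (x.snd i) - Dinv i (y.snd i)) - L i (x.fst - y.fst) := by
    intro i
    simp only [couplingOp, WithLp.sub_snd, WithLp.toLp_snd, PiLp.sub_apply, map_sub]
    abel
  rw [WithLp.prod_inner_apply, PiLp.inner_apply, WithLp.ofLp_fst, WithLp.ofLp_fst, h1,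
    inner_add_right, inner_sum, add_right_comm, ← Finset.sum_add_distrib]
  refine add_nonneg (Finset.sum_nonneg fun i _ => ?_) (hD _ _)
  rw [WithLp.ofLp_snd, WithLp.ofLp_snd, h2, inner_sub_right,
    ContinuousLinearMap.adjoint_inner_right, real_inner_comm, WithLp.sub_snd, PiLp.sub_apply,
    WithLp.sub_fst]
  linarith [hDinv i (x.snd i) (y.snd i)]

theorem lipschitzWith_of_norm_sub_le {F : Type*} [NormedAddCommGroup F] {c : ℝ} {f : F → F}
    (hc : 0 < c) (hf : ∀ x y, ‖f x - f y‖ ≤ c⁻¹ * ‖x - y‖) :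
    LipschitzWith (Real.toNNReal c⁻¹) f := by
  refine LipschitzWith.of_dist_le_mul fun x y => ?_
  rw [dist_eq_norm, dist_eq_norm, Real.coe_toNNReal _ (inv_pos.2 hc).le]
  exact hf x y

theorem exists_lipschitz_couplingOp {D : H → H} {Dinv : ∀ i, G i → G i} (L : ∀ i, H →L[ℝ] G i)
    {η : ℝ} {ν : Fin m → ℝ} (hη : 0 < η) (hν : ∀ i, 0 < ν i)
    (hD : ∀ x y, ‖D x - D y‖ ≤ η⁻¹ * ‖x - y‖)
    (hDinv : ∀ i w w', ‖Dinv i w - Dinv i w'‖ ≤ (ν i)⁻¹ * ‖w - w'‖) :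
    ∃ κ : ℝ, ∀ x y : WithLp 2 (H × PiLp 2 G),
      ‖couplingOp D Dinv L x - couplingOp D Dinv L y‖ ≤ κ * ‖x - y‖ := by
  have hfst : LipschitzWith _ fun z : WithLp 2 (H × PiLp 2 G) => z.fst :=
    (WithLp.fstL 2 ℝ H (PiLp 2 G)).lipschitz
  have hsnd : ∀ i, LipschitzWith _ fun z : WithLp 2 (H × PiLp 2 G) => z.snd i := fun i =>
    ((PiLp.proj 2 G i : PiLp 2 G →L[ℝ] G i).comp (WithLp.sndL 2 ℝ H (PiLp 2 G))).lipschitz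
  have h1 := (∑ i, ((L i).adjoint.comp (PiLp.proj 2 G i : PiLp 2 G →L[ℝ] G i)).comp
    (WithLp.sndL 2 ℝ H (PiLp 2 G))).lipschitz.add ((lipschitzWith_of_norm_sub_le hη hD).comp hfst)
  have h2 := fun i => ((lipschitzWith_of_norm_sub_le (hν i) (hDinv i)).comp (hsnd i)).sub
    ((L i).lipschitz.comp hfst)
  have h2' : ∀ i, ∃ k, LipschitzWith k fun z : WithLp 2 (H × PiLp 2 G) =>
      Dinv i (z.snd i) - L i z.fst := fun i => ⟨_, h2 i⟩
  choose k hk using h2'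
  have hK : LipschitzWith (∑ i, k i) fun (z : WithLp 2 (H × PiLp 2 G)) i =>
      Dinv i (z.snd i) - L i z.fst :=
    fun x y => edist_pi_le_iff.2 fun i => (hk i).weaken
      (Finset.single_le_sum (f := k) (fun _ _ => zero_le) (Finset.mem_univ i)) x y
  have h3 := (WithLp.prod_lipschitzWith_toLp 2 H (PiLp 2 G)).comp
    (h1.prodMk ((PiLp.lipschitzWith_toLp 2 G).comp hK))
  simp only [Function.comp_def, sum_apply,
    ContinuousLinearMap.comp_apply] at h3
  exact ⟨_, fun x y => h3.norm_sub_le x y⟩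

/-! ### Solutions of the primal-dual problem as zeros of the sum in the product space -/

theorem mem_parallelSum_iff {F : Type*} [NormedAddCommGroup F] {M N : SetOp F} {f : F → F}
    (hN : ∀ w, opInv N w = {f w}) {y v : F} :
    v ∈ parallelSum M N y ↔ y - f v ∈ opInv M v := by
  simp only [parallelSum, opInv, opAdd] at hN ⊢
  simp only [hN, Set.mem_ofPred_eq, Set.add_singleton, Set.mem_image]
  constructor
  · rintro ⟨x, hx, rfl⟩
    simpa using hx
  · intro h
    exact ⟨_, h, sub_add_cancel _ _⟩

variable {A B : SetOp H} {D : H → H} {Ai Di : ∀ i, SetOp (G i)} {Dinv : ∀ i, G i → G i}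
  {L : ∀ i, H →L[ℝ] G i}

/-- A zero of the product inclusion is a dual solution together with a primal point that
certifies it. -/
theorem product_zero_iff (hDinv : ∀ i w, opInv (Di i) w = {Dinv i w})
    {z : WithLp 2 (H × PiLp 2 G)} :
    (∃ w ∈ productOp A Ai z, ∃ ξ ∈ productNormalCone (zer B) z,
        w + ξ + couplingOp D Dinv L z = 0) ↔
      (∀ i, z.snd i ∈ parallelSum (Ai i) (Di i) (L i z.fst)) ∧
        0 ∈ A z.fst + {∑ i, (L i).adjoint (z.snd i)} + {D z.fst} + normalCone (zer B) z.fst := by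
  constructor
  · rintro ⟨w, ⟨hw, hw'⟩, ξ, ⟨hξ, hξ'⟩, h0⟩
    have h1 := congrArg WithLp.fst h0
    refine ⟨fun i => ?_, ?_⟩
    · have h2 := congrArg (fun z : WithLp 2 (H × PiLp 2 G) => z.snd i) h0
      simp only [WithLp.add_snd, hξ', couplingOp, WithLp.toLp_snd, PiLp.add_apply,
        WithLp.zero_snd, PiLp.zero_apply, add_zero] at h2
      rw [mem_parallelSum_iff (hDinv i)]
      have h3 : L i z.fst - Dinv i (z.snd i) = w.snd i := by
        rw [← sub_eq_zero, ← neg_eq_zero, ← h2]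
        abel
      rw [h3]
      exact hw' i
    · refine ⟨_, ⟨_, ⟨w.fst, hw, _, rfl, rfl⟩, _, rfl, rfl⟩, ξ.fst, hξ, ?_⟩
      rw [WithLp.zero_fst] at h1
      rw [← h1]
      simp only [WithLp.add_fst, couplingOp, WithLp.toLp_fst]
      abel
  · rintro ⟨h1, _, ⟨_, ⟨a, ha, _, rfl, rfl⟩, _, rfl, rfl⟩, ξ, hξ, h0⟩
    refine ⟨WithLp.toLp 2 (a, WithLp.toLp 2 fun i => L i z.fst - Dinv i (z.snd i)),
      ⟨ha, fun i => (mem_parallelSum_iff (hDinv i)).1 (h1 i)⟩, WithLp.toLp 2 (ξ, 0), ⟨hξ, rfl⟩, ?_⟩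
    refine WithLp.ofLp_injective 2 (Prod.ext ?_ ?_)
    · refine Eq.trans ?_ h0
      simp only [couplingOp, WithLp.ofLp_fst, WithLp.add_fst, WithLp.toLp_fst]
      abel
    · ext i
      simp [couplingOp]

theorem mem_dualSolutions_iff (hDinv : ∀ i w, opInv (Di i) w = {Dinv i w}) {v : PiLp 2 G} :
    v ∈ dualSolutions A B D Ai Di L ↔ ∃ x : H,
      ∃ w ∈ productOp A Ai (WithLp.toLp 2 (x, v)), ∃ ξ ∈ productNormalCone (zer B) (WithLp.toLp 2
        (x, v)), w + ξ + couplingOp D Dinv L (WithLp.toLp 2 (x, v)) = 0 := by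
  simp only [product_zero_iff hDinv]
  rfl

theorem mem_primalSolutions_iff (hDinv : ∀ i w, opInv (Di i) w = {Dinv i w}) {x : H} :
    x ∈ primalSolutions A B D Ai Di L ↔ ∃ v : PiLp 2 G,
      ∃ w ∈ productOp A Ai (WithLp.toLp 2 (x, v)), ∃ ξ ∈ productNormalCone (zer B) (WithLp.toLp 2
        (x, v)), w + ξ + couplingOp D Dinv L (WithLp.toLp 2 (x, v)) = 0 := by
  simp only [product_zero_iff hDinv]
  constructor
  · rintro ⟨_, ⟨_, ⟨a, ha, _, hs, rfl⟩, _, rfl, rfl⟩, ξ, hξ, h0⟩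
    obtain ⟨g, hg, rfl⟩ := Set.mem_fintype_sum _ _ |>.1 hs
    choose v hv hvg using hg
    obtain rfl : (fun i => (L i).adjoint (v i)) = g := funext hvg
    exact ⟨WithLp.toLp 2 v, hv, _, ⟨_, ⟨a, ha, _, rfl, rfl⟩, _, rfl, rfl⟩, ξ, hξ, h0⟩
  · rintro ⟨v, hv, _, ⟨_, ⟨a, ha, _, rfl, rfl⟩, _, rfl, rfl⟩, ξ, hξ, h0⟩
    exact ⟨_, ⟨_, ⟨a, ha, _, Set.mem_fintype_sum _ _ |>.2 ⟨_, fun i => ⟨_, hv i, rfl⟩, rfl⟩, rfl⟩,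
      _, rfl, rfl⟩, ξ, hξ, h0⟩

/-- The primal-dual iteration, reindexed to start at `0`, is a penalty scheme in the product
space. -/
theorem IsPrimalDualIteration.isPenaltyScheme {lam bet : ℕ → ℝ} {x : ℕ → H} {v : ℕ → PiLp 2 G}
    {y₁ p₁ q : ℕ → H} {y₂ p₂ : ℕ → ∀ i, G i}
    (h : IsPrimalDualIteration A B D Ai Dinv L lam bet x v y₁ p₁ q y₂ p₂)
    (hlam : ∀ n ≥ 1, 0 < lam n) (hbet : ∀ n ≥ 1, 0 < bet n)
    (hl2 : Summable fun n => lam (n + 1) ^ 2) (hl1 : ¬ Summable fun n => lam (n + 1))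
    (hfitz : PenaltySummable B lam bet) (hD : ∀ x y, 0 ≤ ⟪x - y, D x - D y⟫)
    (hDinv : ∀ i x y, 0 ≤ ⟪x - y, Dinv i x - Dinv i y⟫) {κ : ℝ}
    (hκ : ∀ x y : WithLp 2 (H × PiLp 2 G),
      ‖couplingOp D Dinv L x - couplingOp D Dinv L y‖ ≤ κ * ‖x - y‖) :
    IsPenaltyScheme (productOp A Ai) (productNormalCone (zer B)) (couplingOp D Dinv L) κ
      (fun n => lam (n + 1)) (fun n => WithLp.toLp 2 (x (n + 1), v (n + 1)))
      (fun n => WithLp.toLp 2 (p₁ (n + 1), WithLp.toLp 2 (p₂ (n + 1)))) where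
  lam_pos n := hlam _ (by omega)
  lam_sq := hl2
  lam_not_summable := hl1
  lipschitz := hκ
  monotone := couplingOp_monotone L hD hDinv
  step n := by
    obtain ⟨a, ha, h1⟩ := mem_resolvent_opSMul.1 (h.p₁_mem (n + 1) (by omega))
    choose b hb h2 using fun i => mem_resolvent_opSMul.1 (h.p₂_mem (n + 1) (by omega) i)
    refine ⟨WithLp.toLp 2 (a, WithLp.toLp 2 b), ⟨ha, hb⟩, WithLp.ofLp_injective 2 (Prod.ext ?_ ?_)⟩
    · exact (h.y₁_eq (n + 1) (by omega)).symm.trans h1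
    · ext i
      exact (h.y₂_eq (n + 1) (by omega) i).symm.trans (h2 i)
  penalty u ξ hξ := by
    obtain ⟨ε, hε, hε0, hle⟩ := hfitz.exists_error hlam hbet hξ.1 h.x_succ
    refine ⟨ε, hε, hε0, fun n => ?_⟩
    -- The dual component of the backward step is the identity.
    have hdual : (WithLp.toLp 2 (p₁ (n + 1), WithLp.toLp 2 (p₂ (n + 1))) + lam (n + 1) •
        (couplingOp D Dinv L (WithLp.toLp 2 (x (n + 1), v (n + 1))) -
          couplingOp D Dinv L (WithLp.toLp 2 (p₁ (n + 1), WithLp.toLp 2 (p₂ (n + 1))))) -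
        WithLp.toLp 2 (x (n + 1 + 1), v (n + 1 + 1))).snd = 0 := by
      ext i
      simp only [couplingOp, WithLp.sub_snd, WithLp.add_snd, WithLp.smul_snd, WithLp.toLp_snd,
        WithLp.toLp_fst, PiLp.sub_apply, PiLp.add_apply, PiLp.smul_apply, PiLp.zero_apply,
        h.v_succ (n + 1) (by omega) i, h.y₂_eq (n + 1) (by omega) i]
      module
    have hprimal : (WithLp.toLp 2 (p₁ (n + 1), WithLp.toLp 2 (p₂ (n + 1))) + lam (n + 1) •
        (couplingOp D Dinv L (WithLp.toLp 2 (x (n + 1), v (n + 1))) -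
          couplingOp D Dinv L (WithLp.toLp 2 (p₁ (n + 1), WithLp.toLp 2 (p₂ (n + 1))))) -
        WithLp.toLp 2 (x (n + 1 + 1), v (n + 1 + 1))).fst =
        x (n + 1) - y₁ (n + 1) + q (n + 1) - x (n + 1 + 1) := by
      simp only [couplingOp, WithLp.sub_fst, WithLp.add_fst, WithLp.smul_fst, WithLp.toLp_snd,
        WithLp.toLp_fst, h.y₁_eq (n + 1) (by omega), h.q_eq (n + 1) (by omega)]
      module
    rw [WithLp.prod_inner_apply, WithLp.prod_inner_apply]
    simp only [WithLp.ofLp_fst, WithLp.ofLp_snd, hdual, hprimal, hξ.2, inner_zero_left,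
      inner_zero_right, add_zero]
    exact hle n

end Product

theorem sum_Icc_one_eq_sum_range {F : Type*} [AddCommMonoid F] (f : ℕ → F) (n : ℕ) :
    ∑ k ∈ Finset.Icc 1 n, f k = ∑ k ∈ Finset.range n, f (k + 1) := by
  rw [Finset.range_eq_Ico, Finset.sum_Ico_add' f 0 n 1]
  rfl

theorem ergodicAverage_eq_range {E : Type*} [NormedAddCommGroup E] [InnerProductSpace ℝ E]
    (lam : ℕ → ℝ) (x : ℕ → E) (n : ℕ) :
    ergodicAverage lam x n = (∑ k ∈ Finset.range n, lam (k + 1))⁻¹ •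
      ∑ k ∈ Finset.range n, lam (k + 1) • x (k + 1) := by
  rw [ergodicAverage, sum_Icc_one_eq_sum_range, sum_Icc_one_eq_sum_range]

/-! ### Convergence of the primal-dual iteration -/

theorem IsStronglyMonotone.of_le {E : Type*} [NormedAddCommGroup E] [InnerProductSpace ℝ E]
    {M : SetOp E} {γ γ' : ℝ} (h : IsStronglyMonotone γ M) (hle : γ' ≤ γ) :
    IsStronglyMonotone γ' M := fun x y u hu v hv =>
  (mul_le_mul_of_nonneg_right hle (sq_nonneg _)).trans (h x y u hu v hv)

theorem isStronglyMonotone_zero_iff {E : Type*} [NormedAddCommGroup E] [InnerProductSpace ℝ E]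
    {M : SetOp E} : IsStronglyMonotone 0 M ↔ IsMonotone M := by
  simp only [IsStronglyMonotone, IsMonotone, zero_mul]

end PrimalDual

theorem mainTheorem5
    {H : Type*} [NormedAddCommGroup H] [InnerProductSpace ℝ H] [CompleteSpace H]
    {m : ℕ} (hm : 1 ≤ m)
    {G : Fin m → Type*} [∀ i, NormedAddCommGroup (G i)]
    [∀ i, InnerProductSpace ℝ (G i)] [∀ i, CompleteSpace (G i)]
    -- the problem
    (A B : PrimalDual.SetOp H) (D : H → H) (Ai Di : ∀ i, PrimalDual.SetOp (G i))
    (Dinv : ∀ i, G i → G i) (L : ∀ i, H →L[ℝ] G i) (η : ℝ) (ν : Fin m → ℝ)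
    (hA : PrimalDual.IsMaxMonotone A) (hB : PrimalDual.IsMaxMonotone B)
    (hC : (PrimalDual.zer B).Nonempty)
    (hη : 0 < η) (hD_mono : ∀ x y, 0 ≤ ⟪x - y, D x - D y⟫)
    (hD_lip : ∀ x y, ‖D x - D y‖ ≤ η⁻¹ * ‖x - y‖)
    (hAi : ∀ i, PrimalDual.IsMaxMonotone (Ai i))
    (hDi : ∀ i, PrimalDual.IsMaxMonotone (Di i))
    (hDinv : ∀ i w, PrimalDual.opInv (Di i) w = {Dinv i w})
    (hν : ∀ i, 0 < ν i)
    (hDinv_lip : ∀ i w w', ‖Dinv i w - Dinv i w'‖ ≤ (ν i)⁻¹ * ‖w - w'‖)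
    (hL : ∀ i, L i ≠ 0)
    -- the algorithm
    (lam bet : ℕ → ℝ) (hlam : ∀ n ≥ 1, 0 < lam n) (hbet : ∀ n ≥ 1, 0 < bet n)
    (x : ℕ → H) (v : ℕ → PiLp 2 G) (y₁ p₁ q : ℕ → H) (y₂ p₂ : ℕ → ∀ i, G i)
    (hiter : PrimalDual.IsPrimalDualIteration A B D Ai Dinv L lam bet x v y₁ p₁ q y₂ p₂)
    -- the convergence hypotheses
    (hsum : PrimalDual.IsMaxMonotone
      (PrimalDual.opAdd A (PrimalDual.normalCone (PrimalDual.zer B))))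
    (hzer : (PrimalDual.zer (PrimalDual.primalOp A B D Ai Di L)).Nonempty)
    (hfitz : PrimalDual.PenaltySummable B lam bet)
    (hl2 : Summable fun n => lam (n + 1) ^ 2) (hl1 : ¬ Summable fun n => lam (n + 1)) :
    (∃ xbar ∈ PrimalDual.primalSolutions A B D Ai Di L,
      PrimalDual.WeaklyConverges (PrimalDual.ergodicAverage lam x) xbar) ∧
    (∃ vbar ∈ PrimalDual.dualSolutions A B D Ai Di L,
      PrimalDual.WeaklyConverges (PrimalDual.ergodicAverage lam v) vbar) ∧
    ((∃ γ > 0, PrimalDual.IsStronglyMonotone γ A) →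
      (∀ i, ∃ γ > 0, PrimalDual.IsStronglyMonotone γ (PrimalDual.opInv (Ai i))) →
      (∃ xbar, PrimalDual.primalSolutions A B D Ai Di L = {xbar} ∧
        Tendsto x atTop (𝓝 xbar)) ∧
      (∃ vbar, PrimalDual.dualSolutions A B D Ai Di L = {vbar} ∧
        Tendsto v atTop (𝓝 vbar))) := by

  have hDinv_mono : ∀ i w w', 0 ≤ ⟪w - w', Dinv i w - Dinv i w'⟫ := by
    intro i w w'
    have hmem : ∀ w, w ∈ Di i (Dinv i w) := fun w =>
      show Dinv i w ∈ PrimalDual.opInv (Di i) w by rw [hDinv i w]; rfl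
    rw [real_inner_comm]
    exact (hDi i).1 _ _ _ (hmem w) _ (hmem w')
  obtain ⟨κ, hκ⟩ := PrimalDual.exists_lipschitz_couplingOp L hη hν hD_lip hDinv_lip
  have hscheme := hiter.isPenaltyScheme hlam hbet hl2 hl1 hfitz hD_mono hDinv_mono hκ
  obtain ⟨x₀, hx₀⟩ := hzer
  obtain ⟨v₀, hz₀⟩ := (PrimalDual.mem_primalSolutions_iff hDinv).1 hx₀
  refine ⟨?_, ?_, ?_⟩
  rotate_left 2
  · rintro ⟨γ₀, hγ₀, hA'⟩ hAi'
    choose γ hγ hγm using hAi'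
    have : Nonempty (Fin m) := ⟨⟨0, hm⟩⟩
    obtain ⟨j, hj⟩ := Finite.exists_min γ
    have hstrong : PrimalDual.IsStronglyMonotone (min γ₀ (γ j)) (PrimalDual.productOp A Ai) :=
      PrimalDual.productOp_isStronglyMonotone (hA'.of_le (min_le_left _ _))
        fun i => (hγm i).of_le ((min_le_right _ _).trans (hj i))
    -- The iterates converge to every solution pair, so there is only one.
    have hlim : ∀ z : WithLp 2 (H × PiLp 2 G), (∃ w ∈ PrimalDual.productOp A Ai z,
        ∃ ξ ∈ PrimalDual.productNormalCone (PrimalDual.zer B) z,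
          w + ξ + PrimalDual.couplingOp D Dinv L z = 0) →
        Tendsto x atTop (𝓝 z.fst) ∧ Tendsto v atTop (𝓝 z.snd) := by
      rintro z ⟨w, hw, ξ, hξ, h0⟩
      have h := hscheme.tendsto_of_stronglyMonotone (lt_min hγ₀ (hγ j)) hstrong hw hξ h0
      exact ⟨(tendsto_add_atTop_iff_nat 1).1
          (((WithLp.fstL 2 ℝ H (PiLp 2 G)).continuous.tendsto z).comp h),
        (tendsto_add_atTop_iff_nat 1).1
          (((WithLp.sndL 2 ℝ H (PiLp 2 G)).continuous.tendsto z).comp h)⟩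
    obtain ⟨hx, hv⟩ := hlim _ hz₀
    refine ⟨⟨x₀, Set.eq_singleton_iff_unique_mem.2 ⟨hx₀, fun x' hx' => ?_⟩, hx⟩,
      ⟨v₀, Set.eq_singleton_iff_unique_mem.2
        ⟨(PrimalDual.mem_dualSolutions_iff hDinv).2 ⟨x₀, hz₀⟩, fun v' hv' => ?_⟩, hv⟩⟩
    · obtain ⟨w, hw⟩ := (PrimalDual.mem_primalSolutions_iff hDinv).1 hx'
      exact tendsto_nhds_unique (hlim _ hw).1 hx
    · obtain ⟨w, hw⟩ := (PrimalDual.mem_dualSolutions_iff hDinv).1 hv'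
      exact tendsto_nhds_unique (hlim _ hw).2 hv
  all_goals
    obtain ⟨a, ha, hconv⟩ := hscheme.exists_weaklyConverges
      (PrimalDual.isStronglyMonotone_zero_iff.1 (PrimalDual.productOp_isStronglyMonotone
        (PrimalDual.isStronglyMonotone_zero_iff.2 hA.1)
        fun i => PrimalDual.isStronglyMonotone_zero_iff.2 (hAi i).opInv.1))
      (PrimalDual.exists_product_resolvent hsum hAi) ⟨_, hz₀⟩
  · refine ⟨a.fst, (PrimalDual.mem_primalSolutions_iff hDinv).2 ⟨a.snd, ha⟩, ?_⟩
    have h := hconv.map (WithLp.fstL 2 ℝ H (PiLp 2 G))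
    simp only [map_smul, map_sum] at h
    rw [show PrimalDual.ergodicAverage lam x = _ from
      funext (PrimalDual.ergodicAverage_eq_range lam x)]
    exact h
  · refine ⟨a.snd, (PrimalDual.mem_dualSolutions_iff hDinv).2 ⟨a.fst, ha⟩, ?_⟩
    have h := hconv.map (WithLp.sndL 2 ℝ H (PiLp 2 G))
    simp only [map_smul, map_sum] at h
    rw [show PrimalDual.ergodicAverage lam v = _ from
      funext (PrimalDual.ergodicAverage_eq_range lam v)]
    exact h
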